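/- Let $\mathbb P^3$ be complex projective 3-space and let $x\mapsto\bar x$, $L\mapsto\bar L$ denote complex conjugation of coordinates, acting on points and on lines. A \emph{real conic} is a curve $C=\{h=q=0\}\subset\mathbb P^3$ of degree 2, where $h$ is a nonzero real linear form and $q$ is a real quadratic form that does not vanish identically on the plane $h=0$; thus smooth conics with or without real points, pairs of intersecting lines and double lines are all allowed. A conic meets a line if the two have a common complex point. Then there are real configurations in general position, consisting of conjugate pairs of linear constraints, that no real conic satisfies. Precisely, in the classical topology: (1) There is a nonempty open set $U\subset \mathbb P^3\times \mathrm{Gr}(2,\mathbb C^4)^2$ such that for every $(p_1,L_1,L_2)\in U$ no real conic passes through $p_1,\bar p_1$ and meets $L_1,\bar L_1,L_2,\bar L_2$. (2) There is a nonempty open set $U\subset \mathrm{Gr}(2,\mathbb C^4)^4$ such that for every $(L_1,L_2,L_3,L_4)\in U$ no real conic meets all eight lines $L_1,\bar L_1,\dots,L_4,\bar L_4$. -/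

import Mathlib

open scoped LinearAlgebra.Projectivization Matrix

namespace RealConics

/-- The complex vector space whose projectivization is `ℙ³`. -/
abbrev V : Type := Fin 4 → ℂ

/-- Complex projective 3-space. -/
abbrev P3 : Type := ℙ ℂ V

/-- The classical topology on `ℙ³(ℂ)`: the quotient topology from `ℂ⁴ ∖ {0}`. -/
noncomputable instance instTopologicalSpaceP3 : TopologicalSpace P3 :=
  TopologicalSpace.coinduced (fun v : {v : V // v ≠ 0} => Projectivization.mk ℂ v.1 v.2)
    inferInstance

/-- Lines in `ℙ³(ℂ)`, that is, the Grassmannian of 2-dimensional subspaces of `ℂ⁴`. -/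
def Line : Type := {W : Submodule ℂ V // Module.finrank ℂ W = 2}

/-- The line spanned by a pair of linearly independent vectors. -/
def Line.ofFrame (f : {f : Fin 2 → V // LinearIndependent ℂ f}) : Line :=
  ⟨Submodule.span ℂ (Set.range f.1), by simpa using finrank_span_eq_card f.2⟩

/-- The classical topology on the Grassmannian: the quotient topology from the space of
linearly independent pairs of vectors. -/
noncomputable instance instTopologicalSpaceLine : TopologicalSpace Line :=
  TopologicalSpace.coinduced Line.ofFrame inferInstance

/-- A point lies on a line. -/
def Line.Contains (L : Line) (x : P3) : Prop := x.submodule ≤ L.1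

/-- Coordinatewise complex conjugation on `ℂ⁴`, as a conjugate-linear map. -/
noncomputable def conjV : V →ₛₗ[starRingEnd ℂ] V where
  toFun v := star v
  map_add' v w := star_add v w
  map_smul' c v := star_smul c v

theorem conjV_injective : Function.Injective conjV := fun _ _ h => star_injective h

/-- The complex conjugate of a point of `ℙ³`. -/
noncomputable def conjPoint (x : P3) : P3 := Projectivization.map conjV conjV_injective x

theorem finrank_map_conjV (W : Submodule ℂ V) :
    Module.finrank ℂ (W.map conjV) = Module.finrank ℂ W := by
  let e : W ≃+ (W.map conjV) :=
    { toFun := fun w => ⟨conjV w.1, Submodule.mem_map_of_mem w.2⟩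
      invFun := fun w => ⟨conjV w.1, by
        obtain ⟨v, hv, h⟩ := w.2
        rw [← h]
        change star (star v) ∈ W
        rwa [star_star]⟩
      left_inv := fun w => Subtype.ext (star_star w.1)
      right_inv := fun w => Subtype.ext (star_star w.1)
      map_add' := fun a b => Subtype.ext (map_add conjV a.1 b.1) }
  have h := rank_eq_of_equiv_equiv (R := ℂ) (R' := ℂ) (starRingEnd ℂ) e
    (star_involutive.bijective) (fun r m => Subtype.ext (conjV.map_smulₛₗ r m.1))
  simp only [Module.finrank, h]

/-- The complex conjugate of a line in `ℙ³`. -/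
noncomputable def conjLine (L : Line) : Line :=
  ⟨L.1.map conjV, (finrank_map_conjV L.1).trans L.2⟩

/-- A real conic in `ℙ³`: the intersection of a real plane `∑ aᵢ xᵢ = 0` with a real quadric
`∑ Sᵢⱼ xᵢ xⱼ = 0` that does not contain this plane. Smooth conics (with or without real points),
pairs of (real or conjugate) intersecting lines, and double lines are all included. -/
structure RealConic where
  /-- coefficients of the linear equation of the plane of the conic -/
  a : Fin 4 → ℝ
  /-- symmetric coefficient matrix of the quadratic equation of the conic in its plane -/
  S : Matrix (Fin 4) (Fin 4) ℝ
  a_ne_zero : a ≠ 0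
  symm : S.IsSymm
  not_plane : ∃ x : Fin 4 → ℝ, a ⬝ᵥ x = 0 ∧ x ⬝ᵥ (S *ᵥ x) ≠ 0

/-- The set of complex points of a real conic. -/
def RealConic.points (C : RealConic) : Set P3 :=
  {x | ∀ v ∈ x.submodule,
    (∑ i, (C.a i : ℂ) * v i = 0) ∧ (∑ i, ∑ j, (C.S i j : ℂ) * v i * v j = 0)}

/-- The conic passes through the point `x`. -/
def RealConic.PassesThrough (C : RealConic) (x : P3) : Prop := x ∈ C.points

/-- The conic intersects the line `L`, at some complex point. -/
def RealConic.Meets (C : RealConic) (L : Line) : Prop := ∃ x ∈ C.points, L.Contains x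

end RealConics

/-!
A real conic through a point also passes through the conjugate point, so only the conditions on
`p₁` and the `Lᵢ` matter. Real conics form a compact space: the plane can be given by a unit vector
`a`, and the quadratic form by a unit vector among the forms with `a` in their radical
(`isCompact_normalizedConics`, `RealConic.exists_normalized`). A plane `a` meets the line with frame
`f` in a point `planeSection a f` that is polynomial in `a` and `f`. Therefore the configurations
met by some real conic are closed in the space of frames, and since the maps from frames to lines
and from vectors to points are open, it suffices to give one configuration of each kind that no real
conic meets.

Identify `ℝ⁴` with the quaternions. The plane orthogonal to the unit vector `a` has the orthonormal
basis `ia, ja, ka`. If `z` and `w` are complex imaginary quaternions with `z² = w²`, not both zero, then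
the points `za + aw`, for varying complex `a`, form a line, and `za + aw` is the point of
this line in the plane orthogonal to `a`, for real `a`. Its coordinates in the basis are `z + Rw`, where `R` is the rotation
`w ↦ a w a⁻¹`. So for four lines one needs pairs `(z, w)` such that for no rotation `R` all four
points `z + Rw` lie on a real conic. Two of the lines are chosen with `w = 0`, and the other two
with the same real `w`, so that only the unit vector `r` in the direction of `Rw` enters; the points
`(1, i, 0)`, `(0, 1, i)`, `(0, 5, 4i) + 3r` and `(3, 5, 5i) + 3r` are as desired
(`baseFrame₄_not_mem`). For a point and two lines, only a pencil of planes is relevant, and a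
configuration invariant under a group of rotations that is transitive on this pencil reduces the
claim to a single plane, where no real conic contains the points `(1, i, 0)`, `(0, 1, i)` and
`(1, 1, i)` (`basePoint_baseFrame₂_not_mem`).
-/

namespace RealConics

/-! ### Real planes and real quadrics evaluated at complex vectors -/

/-- The value of the real linear form with coefficients `a` at a complex vector. -/
noncomputable def lin (a : Fin 4 → ℝ) (v : V) : ℂ := ∑ i, (a i : ℂ) * v i

/-- The value of the real quadratic form with matrix `S` at a complex vector. -/
noncomputable def quad (S : Matrix (Fin 4) (Fin 4) ℝ) (v : V) : ℂ :=
  ∑ i, ∑ j, (S i j : ℂ) * v i * v j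

/-- The intersection of the plane `a` with the line spanned by `f 0` and `f 1`, as a vector that
depends polynomially on `a` and `f`. It is zero if the plane contains the line. -/
noncomputable def planeSection (a : Fin 4 → ℝ) (f : Fin 2 → V) : V :=
  lin a (f 1) • f 0 - lin a (f 0) • f 1

theorem lin_add (a : Fin 4 → ℝ) (v w : V) : lin a (v + w) = lin a v + lin a w := by
  simp [lin, mul_add, Finset.sum_add_distrib]

theorem lin_smul (a : Fin 4 → ℝ) (c : ℂ) (v : V) : lin a (c • v) = c * lin a v := by
  simp only [lin, Finset.mul_sum, Pi.smul_apply, smul_eq_mul]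
  exact Finset.sum_congr rfl fun i _ => by ring

theorem quad_smul (S : Matrix (Fin 4) (Fin 4) ℝ) (c : ℂ) (v : V) :
    quad S (c • v) = c ^ 2 * quad S v := by
  simp only [quad, Finset.mul_sum, Pi.smul_apply, smul_eq_mul]
  exact Finset.sum_congr rfl fun i _ => Finset.sum_congr rfl fun j _ => by ring

/-- If a point of the line spanned by `f` lies on the conic, then the conic contains
`planeSection a f`: this vector is a multiple of the given point, possibly zero. -/
theorem quad_planeSection_eq_zero {a : Fin 4 → ℝ} {S : Matrix (Fin 4) (Fin 4) ℝ}
    {f : Fin 2 → V} {s t : ℂ} (hv : s • f 0 + t • f 1 ≠ 0)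
    (hl : lin a (s • f 0 + t • f 1) = 0) (hq : quad S (s • f 0 + t • f 1) = 0) :
    quad S (planeSection a f) = 0 := by
  have hl' := hl
  rw [lin_add, lin_smul, lin_smul] at hl'
  suffices h : ∃ c : ℂ, planeSection a f = c • (s • f 0 + t • f 1) by
    obtain ⟨c, hc⟩ := h
    rw [hc, quad_smul, hq, mul_zero]
  by_cases hs : s = 0
  · subst hs
    have ht : t ≠ 0 := by
      rintro rfl
      simp at hv
    have h1 : lin a (f 1) = 0 := by simpa [ht] using hl'
    refine ⟨-lin a (f 0) / t, ?_⟩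
    ext i
    simp only [planeSection, h1, Pi.sub_apply, Pi.add_apply, Pi.smul_apply, smul_eq_mul]
    field_simp
    ring
  · refine ⟨lin a (f 1) / s, ?_⟩
    have h0 : lin a (f 0) = -(t * lin a (f 1)) / s := by
      field_simp
      linear_combination hl'
    ext i
    simp only [planeSection, h0, Pi.sub_apply, Pi.add_apply, Pi.smul_apply, smul_eq_mul]
    field_simp
    ring

theorem RealConic.exists_of_meets_ofFrame {C : RealConic}
    {f : {f : Fin 2 → V // LinearIndependent ℂ f}} (h : C.Meets (Line.ofFrame f)) :
    ∃ s t : ℂ, s • f.1 0 + t • f.1 1 ≠ 0 ∧ lin C.a (s • f.1 0 + t • f.1 1) = 0 ∧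
      quad C.S (s • f.1 0 + t • f.1 1) = 0 := by
  obtain ⟨x, hx, hL⟩ := h
  have hrep : x.rep ∈ x.submodule := by
    rw [x.submodule_eq]
    exact Submodule.mem_span_singleton_self _
  have hmem : x.rep ∈ Submodule.span ℂ (Set.range f.1) := hL hrep
  obtain ⟨c, hc⟩ := (Submodule.mem_span_range_iff_exists_fun ℂ).1 hmem
  rw [Fin.sum_univ_two] at hc
  refine ⟨c 0, c 1, ?_, ?_, ?_⟩ <;> rw [hc]
  · exact x.rep_nonzero
  · exact (hx _ hrep).1
  · exact (hx _ hrep).2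

theorem RealConic.eq_zero_of_passesThrough_mk {C : RealConic} {v : V} (hv : v ≠ 0)
    (h : C.PassesThrough (Projectivization.mk ℂ v hv)) : lin C.a v = 0 ∧ quad C.S v = 0 :=
  h v (by rw [Projectivization.submodule_mk]; exact Submodule.mem_span_singleton_self _)

/-! ### Compactness of the space of real conics -/

/-- Normalized equations of real conics: the linear form is a unit vector, and the quadratic form
is a unit vector among the forms whose radical contains the normal vector of the plane. -/
def normalizedConics : Set ((Fin 4 → ℝ) × Matrix (Fin 4) (Fin 4) ℝ) :=
  {k | k.1 ⬝ᵥ k.1 = 1 ∧ k.2.IsSymm ∧ k.2 *ᵥ k.1 = 0 ∧ ∑ i, ∑ j, k.2 i j ^ 2 = 1}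

theorem isCompact_normalizedConics : IsCompact normalizedConics := by
  have hbox : IsCompact (Set.pi Set.univ (fun _ : Fin 4 => Set.Icc (-1 : ℝ) 1) ×ˢ
      (Set.pi Set.univ (fun _ : Fin 4 => Set.pi Set.univ (fun _ : Fin 4 => Set.Icc (-1 : ℝ) 1)) :
        Set (Matrix (Fin 4) (Fin 4) ℝ))) :=
    (isCompact_univ_pi fun _ => isCompact_Icc).prod
      (isCompact_univ_pi fun _ => isCompact_univ_pi fun _ => isCompact_Icc)
  refine hbox.of_isClosed_subset ?_ ?_
  · refine (isClosed_eq (by fun_prop) continuous_const).inter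
      ((isClosed_eq (by fun_prop) (by fun_prop)).inter
        ((isClosed_eq (by fun_prop) continuous_const).inter
          (isClosed_eq (by fun_prop) continuous_const)))
  · rintro ⟨a, S⟩ ⟨h1, -, -, h2⟩
    simp only [dotProduct] at h1 h2
    refine ⟨fun i _ => ?_, fun i _ j _ => ?_⟩
    · have := Finset.single_le_sum (f := fun i => a i * a i) (fun i _ => mul_self_nonneg _)
        (Finset.mem_univ i)
      exact abs_le.1 (abs_le_one_iff_mul_self_le_one.2 (this.trans h1.le))
    · have h3 := Finset.single_le_sum (f := fun i => ∑ j, S i j ^ 2)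
        (fun i _ => Finset.sum_nonneg fun j _ => sq_nonneg _) (Finset.mem_univ i)
      have h4 := Finset.single_le_sum (f := fun j => S i j ^ 2)
        (fun j _ => sq_nonneg _) (Finset.mem_univ j)
      exact abs_le.1 ((sq_le_one_iff_abs_le_one _).1 (h4.trans (h3.trans h2.le)))

theorem quad_eq_dotProduct (S : Matrix (Fin 4) (Fin 4) ℝ) (v : V) :
    quad S v = v ⬝ᵥ (S.map Complex.ofReal *ᵥ v) := by
  simp only [quad, dotProduct, Matrix.mulVec, Finset.mul_sum, Matrix.map_apply]
  exact Finset.sum_congr rfl fun i _ => Finset.sum_congr rfl fun j _ => by ring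

theorem quad_ofReal (S : Matrix (Fin 4) (Fin 4) ℝ) (x : Fin 4 → ℝ) :
    quad S (fun i => (x i : ℂ)) = ((x ⬝ᵥ (S *ᵥ x) : ℝ) : ℂ) := by
  simp only [quad, dotProduct, Matrix.mulVec, Finset.mul_sum]
  push_cast
  exact Finset.sum_congr rfl fun i _ => Finset.sum_congr rfl fun j _ => by ring

/-- Compressing a quadratic form to the hyperplane orthogonal to a unit vector `a` does not change
its values there. -/
theorem quad_compress {a : Fin 4 → ℝ} (S : Matrix (Fin 4) (Fin 4) ℝ) {v : V} (hv : lin a v = 0) :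
    quad ((1 - Matrix.vecMulVec a a) * S * (1 - Matrix.vecMulVec a a)) v = quad S v := by
  have hP : (1 - Matrix.vecMulVec a a).map Complex.ofReal *ᵥ v = v := by
    ext i
    have : ∑ j, ((a i : ℂ) * a j) * v j = 0 := by
      simp only [mul_assoc, ← Finset.mul_sum]
      rw [show ∑ j, (a j : ℂ) * v j = 0 from hv, mul_zero]
    simp only [Matrix.mulVec, dotProduct, Matrix.map_apply, Matrix.sub_apply,
      Matrix.vecMulVec_apply, Complex.ofReal_sub, Complex.ofReal_mul, sub_mul,
      Finset.sum_sub_distrib, this, sub_zero]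
    simp [Matrix.one_apply, apply_ite Complex.ofReal]
  have hPt : v ᵥ* (1 - Matrix.vecMulVec a a).map Complex.ofReal = v := by
    rw [← Matrix.mulVec_transpose, ← Matrix.transpose_map, Matrix.transpose_sub,
      Matrix.transpose_one, Matrix.transpose_vecMulVec, hP]
  have hmap (A B : Matrix (Fin 4) (Fin 4) ℝ) :
      (A * B).map Complex.ofReal = A.map Complex.ofReal * B.map Complex.ofReal :=
    Matrix.map_mul (f := Complex.ofRealHom)
  rw [quad_eq_dotProduct, quad_eq_dotProduct, hmap, hmap, ← Matrix.mulVec_mulVec, hP,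
    ← Matrix.mulVec_mulVec, Matrix.dotProduct_mulVec, hPt]

/-- Every real conic has normalized equations. -/
theorem RealConic.exists_normalized (C : RealConic) :
    ∃ k ∈ normalizedConics, ∀ v : V, lin C.a v = 0 → quad C.S v = 0 →
      lin k.1 v = 0 ∧ quad k.2 v = 0 := by
  have hpos : 0 < C.a ⬝ᵥ C.a :=
    lt_of_le_of_ne (Finset.sum_nonneg fun i _ => mul_self_nonneg _)
      fun h => C.a_ne_zero (dotProduct_self_eq_zero.1 h.symm)
  set c : ℝ := (√(C.a ⬝ᵥ C.a))⁻¹ with hc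
  set a : Fin 4 → ℝ := c • C.a with ha
  have haa : a ⬝ᵥ a = 1 := by
    rw [ha, smul_dotProduct, dotProduct_smul, smul_eq_mul, smul_eq_mul, ← mul_assoc, hc,
      ← mul_inv, Real.mul_self_sqrt hpos.le, inv_mul_cancel₀ hpos.ne']
  have hlin (v : V) (hv : lin C.a v = 0) : lin a v = 0 := by
    have : lin a v = (c : ℂ) * lin C.a v := by
      simp only [lin, ha, Finset.mul_sum, Pi.smul_apply, smul_eq_mul]
      exact Finset.sum_congr rfl fun i _ => by push_cast; ring
    rw [this, hv, mul_zero]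
  set P : Matrix (Fin 4) (Fin 4) ℝ := 1 - Matrix.vecMulVec a a with hP
  have hPt : Pᵀ = P := by
    rw [hP, Matrix.transpose_sub, Matrix.transpose_one, Matrix.transpose_vecMulVec]
  have hPa : P *ᵥ a = 0 := by
    rw [hP, Matrix.sub_mulVec, Matrix.one_mulVec, Matrix.vecMulVec_mulVec, haa]
    simp
  set S : Matrix (Fin 4) (Fin 4) ℝ := P * C.S * P with hS
  have hSn : 0 < ∑ i, ∑ j, S i j ^ 2 := by
    refine lt_of_le_of_ne (Finset.sum_nonneg fun i _ => Finset.sum_nonneg fun j _ => sq_nonneg _)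
      fun h => ?_
    have hzero : S = 0 := by
      ext i j
      have h1 := (Finset.sum_eq_zero_iff_of_nonneg
        fun i _ => Finset.sum_nonneg fun j _ => sq_nonneg (S i j)).1 h.symm i (Finset.mem_univ i)
      have h2 := (Finset.sum_eq_zero_iff_of_nonneg fun j _ => sq_nonneg (S i j)).1 h1 j
        (Finset.mem_univ j)
      simpa using h2
    obtain ⟨x, hx, hxS⟩ := C.not_plane
    have hx' : lin C.a (fun i => (x i : ℂ)) = 0 := by
      rw [lin]
      exact_mod_cast hx
    have hq := quad_compress C.S (hlin _ hx')
    rw [← hP, ← hS, hzero, quad_ofReal, quad_ofReal] at hq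
    apply hxS
    simpa using hq.symm
  set d : ℝ := (√(∑ i, ∑ j, S i j ^ 2))⁻¹ with hd
  refine ⟨(a, d • S), ⟨haa, ?_, ?_, ?_⟩, fun v hv hq => ⟨hlin v hv, ?_⟩⟩
  · rw [Matrix.IsSymm, Matrix.transpose_smul, hS, Matrix.transpose_mul, Matrix.transpose_mul, hPt,
      C.symm.eq, Matrix.mul_assoc]
  · rw [Matrix.smul_mulVec, hS, ← Matrix.mulVec_mulVec, hPa, Matrix.mulVec_zero, smul_zero]
  · simp only [Matrix.smul_apply, smul_eq_mul, mul_pow, ← Finset.mul_sum]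
    rw [hd, inv_pow, Real.sq_sqrt hSn.le, inv_mul_cancel₀ hSn.ne']
  · have : quad (d • S) v = (d : ℂ) * quad S v := by
      simp only [quad, Finset.mul_sum, Matrix.smul_apply, smul_eq_mul]
      exact Finset.sum_congr rfl fun i _ => Finset.sum_congr rfl fun j _ => by push_cast; ring
    rw [this, hS, hP, quad_compress C.S (hlin v hv), hq, mul_zero]

/-! ### The two configurations -/

/-- A symmetric form that vanishes on the hyperplane orthogonal to a unit vector of its radical
is zero, so it is not a normalized quadratic form. -/
theorem not_mem_normalizedConics {k : (Fin 4 → ℝ) × Matrix (Fin 4) (Fin 4) ℝ}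
    (h : ∀ x : Fin 4 → ℝ, k.1 ⬝ᵥ x = 0 → x ⬝ᵥ (k.2 *ᵥ x) = 0) : k ∉ normalizedConics := by
  obtain ⟨a, S⟩ := k
  rintro ⟨haa, hsymm, hSa, hS⟩
  simp only at haa hsymm hSa hS h
  have hanySa (y : Fin 4 → ℝ) : a ⬝ᵥ (S *ᵥ y) = 0 := by
    rw [Matrix.dotProduct_mulVec, ← Matrix.mulVec_transpose, hsymm.eq, hSa, zero_dotProduct]
  have hall (y : Fin 4 → ℝ) : y ⬝ᵥ (S *ᵥ y) = 0 := by
    have := h (y - (a ⬝ᵥ y) • a) (by simp [dotProduct_sub, dotProduct_smul, haa])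
    simpa [Matrix.mulVec_sub, Matrix.mulVec_smul, hSa, sub_dotProduct, smul_dotProduct, hanySa]
      using this
  have hentry (i j : Fin 4) : S i j = 0 := by
    have hi := hall (Pi.single i 1)
    have hj := hall (Pi.single j 1)
    have hij := hall (Pi.single i 1 + Pi.single j 1)
    have hs := hsymm.apply i j
    simp [Matrix.mulVec_add, dotProduct_add, add_dotProduct] at hi hj hij
    linarith
  simp [hentry] at hS

theorem dotProduct_mulVec_comm {S : Matrix (Fin 4) (Fin 4) ℝ} (hS : S.IsSymm)
    (x y : Fin 4 → ℝ) : x ⬝ᵥ (S *ᵥ y) = y ⬝ᵥ (S *ᵥ x) := by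
  rw [Matrix.dotProduct_mulVec, ← Matrix.mulVec_transpose, hS.eq, dotProduct_comm]

/-- A real quadric contains the point `x + iy` if and only if `x` and `y` are orthogonal vectors of
equal norm for the real quadratic form. -/
theorem quad_add_I_mul {S : Matrix (Fin 4) (Fin 4) ℝ} (hS : S.IsSymm) (x y : Fin 4 → ℝ) {v : V}
    (hv : ∀ i, v i = x i + Complex.I * y i) (hq : quad S v = 0) :
    x ⬝ᵥ (S *ᵥ x) = y ⬝ᵥ (S *ᵥ y) ∧ x ⬝ᵥ (S *ᵥ y) = 0 := by
  have key : quad S v = ((x ⬝ᵥ (S *ᵥ x) - y ⬝ᵥ (S *ᵥ y) : ℝ) : ℂ) +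
      ((x ⬝ᵥ (S *ᵥ y) + y ⬝ᵥ (S *ᵥ x) : ℝ) : ℂ) * Complex.I := by
    simp only [quad, dotProduct, Matrix.mulVec, Finset.mul_sum, hv]
    push_cast
    simp only [← Finset.sum_add_distrib, ← Finset.sum_sub_distrib, Finset.sum_mul]
    refine Finset.sum_congr rfl fun i _ => Finset.sum_congr rfl fun j _ => ?_
    linear_combination (S i j : ℂ) * y i * y j * Complex.I_sq
  rw [hq] at key
  have hre := congrArg Complex.re key
  have him := congrArg Complex.im key
  simp only [Complex.add_re, Complex.add_im, Complex.mul_re, Complex.mul_im, Complex.ofReal_re,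
    Complex.ofReal_im, Complex.I_re, Complex.I_im, Complex.zero_re, Complex.zero_im] at hre him
  have := dotProduct_mulVec_comm hS x y
  constructor <;> linarith

/-- A symmetric form that vanishes on all pairs from `u₁, u₂, u₃` vanishes on their span. -/
theorem quadratic_eq_zero_of_span {S : Matrix (Fin 4) (Fin 4) ℝ} (hS : S.IsSymm)
    {u₁ u₂ u₃ x : Fin 4 → ℝ} {c₁ c₂ c₃ : ℝ} (hx : x = c₁ • u₁ + c₂ • u₂ + c₃ • u₃)
    (h11 : u₁ ⬝ᵥ (S *ᵥ u₁) = 0) (h22 : u₂ ⬝ᵥ (S *ᵥ u₂) = 0) (h33 : u₃ ⬝ᵥ (S *ᵥ u₃) = 0)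
    (h12 : u₁ ⬝ᵥ (S *ᵥ u₂) = 0) (h13 : u₁ ⬝ᵥ (S *ᵥ u₃) = 0) (h23 : u₂ ⬝ᵥ (S *ᵥ u₃) = 0) :
    x ⬝ᵥ (S *ᵥ x) = 0 := by
  have h21 := (dotProduct_mulVec_comm hS u₂ u₁).trans h12
  have h31 := (dotProduct_mulVec_comm hS u₃ u₁).trans h13
  have h32 := (dotProduct_mulVec_comm hS u₃ u₂).trans h23
  simp [hx, Matrix.mulVec_add, Matrix.mulVec_smul, dotProduct_add, add_dotProduct,
    smul_dotProduct, dotProduct_smul, h11, h22, h33, h12, h13, h23, h21, h31, h32]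

/-- A vector representing the point of the first configuration. -/
noncomputable def basePoint : V := ![1, Complex.I, 0, 0]

/-- Frames of the two lines of the first configuration. -/
noncomputable def baseFrame₂ : Fin 2 → Fin 2 → V :=
  ![![![0, 1, 0, Complex.I], ![-1, 0, -Complex.I, 0]],
    ![![1, 1, 0, Complex.I], ![-1, 1, -Complex.I, 0]]]

/-- Frames of the four lines of the second configuration. -/
noncomputable def baseFrame₄ : Fin 4 → Fin 2 → V :=
  ![![![0, 1, Complex.I, 0], ![1, 0, 0, Complex.I]],
    ![![0, 0, 1, Complex.I], ![1, Complex.I, 0, 0]],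
    ![![0, 3, 5, 4 * Complex.I], ![3, 0, -4 * Complex.I, 5]],
    ![![0, 6, 5, 5 * Complex.I], ![6, 0, -5 * Complex.I, 5]]]

theorem linearIndependent_baseFrame₂ (i : Fin 2) : LinearIndependent ℂ (baseFrame₂ i) := by
  rw [show baseFrame₂ i = ![baseFrame₂ i 0, baseFrame₂ i 1] from
    funext (Fin.forall_fin_two.2 ⟨rfl, rfl⟩), LinearIndependent.pair_iff]
  intro s t h
  have h0 := congrFun h 0
  have h1 := congrFun h 1
  have h2 := congrFun h 2
  fin_cases i <;> simp [baseFrame₂] at h0 h1 h2 ⊢ <;> simp_all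

theorem linearIndependent_baseFrame₄ (i : Fin 4) : LinearIndependent ℂ (baseFrame₄ i) := by
  rw [show baseFrame₄ i = ![baseFrame₄ i 0, baseFrame₄ i 1] from
    funext (Fin.forall_fin_two.2 ⟨rfl, rfl⟩), LinearIndependent.pair_iff]
  intro s t h
  have h0 := congrFun h 0
  have h1 := congrFun h 1
  have h2 := congrFun h 2
  fin_cases i <;> simp [baseFrame₄] at h0 h1 h2 ⊢ <;> simp_all

theorem basePoint_ne_zero : basePoint ≠ 0 := fun h => by
  simpa [basePoint] using congrFun h 0

/-- No real conic passes through the point and meets both lines of the first configuration. The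
plane of such a conic is `a = (0, 0, c, s)`, and in the orthonormal basis `g₁, g₂, b` of this
plane the three points have the homogeneous coordinates `(1, i, 0)`, `(0, 1, i)` and `(1, 1, i)`,
whatever `c` and `s` are. No real conic contains these three points. -/
theorem basePoint_baseFrame₂_not_mem {k : (Fin 4 → ℝ) × Matrix (Fin 4) (Fin 4) ℝ}
    (hp : lin k.1 basePoint = 0) (hq : quad k.2 basePoint = 0)
    (h : ∀ i, quad k.2 (planeSection k.1 (baseFrame₂ i)) = 0) : k ∉ normalizedConics := by
  intro hk
  refine not_mem_normalizedConics ?_ hk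
  obtain ⟨a, S⟩ := k
  obtain ⟨haa, hS, -, -⟩ := hk
  simp only at haa hS hp hq h ⊢
  have ha0 : a 0 = 0 := by
    simpa [lin, basePoint, Fin.sum_univ_four] using congrArg Complex.re hp
  have ha1 : a 1 = 0 := by
    simpa [lin, basePoint, Fin.sum_univ_four] using congrArg Complex.im hp
  have hcs : a 2 * a 2 + a 3 * a 3 = 1 := by
    simpa [dotProduct, Fin.sum_univ_four, ha0, ha1] using haa
  set g₁ : Fin 4 → ℝ := ![a 2, a 3, 0, 0] with hg₁
  set g₂ : Fin 4 → ℝ := ![-a 3, a 2, 0, 0] with hg₂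
  set b : Fin 4 → ℝ := ![0, 0, -a 3, a 2] with hb
  have hq' : quad S (fun i => g₁ i + Complex.I * g₂ i) = 0 := by
    have : (fun i => (g₁ i : ℂ) + Complex.I * g₂ i) =
        ((a 2 : ℂ) - a 3 * Complex.I) • basePoint := by
      ext i
      fin_cases i <;> apply Complex.ext <;>
        simp [hg₁, hg₂, basePoint]
    rw [this, quad_smul, hq, mul_zero]
  obtain ⟨e1, e2⟩ := quad_add_I_mul hS g₁ g₂ (fun _ => rfl) hq'
  obtain ⟨e3, e4⟩ := quad_add_I_mul hS b (-g₂) (fun i => by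
    fin_cases i <;> apply Complex.ext <;>
      simp [hb, hg₂, planeSection, baseFrame₂, lin, Fin.sum_univ_four, ha0, ha1]) (h 0)
  obtain ⟨e5, e6⟩ := quad_add_I_mul hS b (-(g₁ + g₂)) (fun i => by
    fin_cases i <;> apply Complex.ext <;>
      simp [hb, hg₁, hg₂, planeSection, baseFrame₂, lin, Fin.sum_univ_four, ha0, ha1] <;>
      ring) (h 1)
  have c1 := dotProduct_mulVec_comm hS g₂ g₁
  have c2 := dotProduct_mulVec_comm hS b g₁
  have c3 := dotProduct_mulVec_comm hS b g₂
  simp only [Matrix.mulVec_add, Matrix.mulVec_neg, dotProduct_add, add_dotProduct, dotProduct_neg,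
    neg_dotProduct, neg_neg] at e3 e4 e5 e6
  intro x hx
  have hx' : a 2 * x 2 + a 3 * x 3 = 0 := by
    simpa [dotProduct, Fin.sum_univ_four, ha0, ha1] using hx
  refine quadratic_eq_zero_of_span hS (u₁ := g₁) (u₂ := g₂) (u₃ := b)
    (c₁ := a 2 * x 0 + a 3 * x 1) (c₂ := -a 3 * x 0 + a 2 * x 1)
    (c₃ := -a 3 * x 2 + a 2 * x 3) ?_ ?_ ?_ ?_ ?_ ?_ ?_
  · ext i
    fin_cases i <;> simp [hg₁, hg₂, hb]
    · linear_combination -x 0 * hcs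
    · linear_combination -x 1 * hcs
    · linear_combination -x 2 * hcs + a 2 * hx'
    · linear_combination -x 3 * hcs + a 3 * hx'
  all_goals linarith

/-- No real conic meets all four lines of the second configuration. Identify `ℝ⁴` with the
quaternions, `a` being the unit vector normal to the plane of the conic. The vectors `u₁ = ia`,
`u₂ = ja`, `u₃ = ka` are an orthonormal basis of this plane. In this basis `ai` has coordinates
`r = (r₁, r₂, r₃)`, the image of the first basis vector under the rotation given by `a`, and the
plane meets the four lines in the points `(1, i, 0)`, `(0, 1, i)`, `(0, 5, 4i) + 3r` and
`(3, 5, 5i) + 3r`. -/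
theorem baseFrame₄_not_mem {k : (Fin 4 → ℝ) × Matrix (Fin 4) (Fin 4) ℝ}
    (h : ∀ i, quad k.2 (planeSection k.1 (baseFrame₄ i)) = 0) : k ∉ normalizedConics := by
  intro hk
  refine not_mem_normalizedConics ?_ hk
  obtain ⟨a, S⟩ := k
  obtain ⟨haa, hS, -, -⟩ := hk
  simp only at haa hS h ⊢
  have hN : a 0 * a 0 + a 1 * a 1 + a 2 * a 2 + a 3 * a 3 = 1 := by
    simpa [dotProduct, Fin.sum_univ_four] using haa
  set u₁ : Fin 4 → ℝ := ![-a 1, a 0, -a 3, a 2] with hu₁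
  set u₂ : Fin 4 → ℝ := ![-a 2, a 3, a 0, -a 1] with hu₂
  set u₃ : Fin 4 → ℝ := ![-a 3, -a 2, a 1, a 0] with hu₃
  -- Only `|r| = 1` is used below: no real conic contains the four points for any unit vector `r`.
  set r₁ : ℝ := a 0 * a 0 + a 1 * a 1 - a 2 * a 2 - a 3 * a 3 with hr₁
  set r₂ : ℝ := 2 * (a 1 * a 2 + a 0 * a 3) with hr₂
  set r₃ : ℝ := 2 * (a 1 * a 3 - a 0 * a 2) with hr₃
  have hr : r₁ ^ 2 + r₂ ^ 2 + r₃ ^ 2 = 1 := by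
    have : r₁ ^ 2 + r₂ ^ 2 + r₃ ^ 2 =
        (a 0 * a 0 + a 1 * a 1 + a 2 * a 2 + a 3 * a 3) ^ 2 := by
      rw [hr₁, hr₂, hr₃]
      ring
    rw [this, hN, one_pow]
  have hF : (![-a 1, a 0, a 3, -a 2] : Fin 4 → ℝ) = r₁ • u₁ + r₂ • u₂ + r₃ • u₃ := by
    ext i
    fin_cases i <;> simp [hu₁, hu₂, hu₃, hr₁, hr₂, hr₃]
    · linear_combination a 1 * hN
    · linear_combination -a 0 * hN
    · linear_combination -a 3 * hN
    · linear_combination a 2 * hN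
  obtain ⟨e1, e2⟩ := quad_add_I_mul hS u₁ u₂ (fun i => by
    fin_cases i <;> apply Complex.ext <;>
      simp [hu₁, hu₂, planeSection, baseFrame₄, lin, Fin.sum_univ_four]) (h 0)
  obtain ⟨e3, e4⟩ := quad_add_I_mul hS u₂ u₃ (fun i => by
    fin_cases i <;> apply Complex.ext <;>
      simp [hu₂, hu₃, planeSection, baseFrame₄, lin, Fin.sum_univ_four]) (h 1)
  obtain ⟨e5, e6⟩ := quad_add_I_mul hS
    ((15 : ℝ) • u₂ + (9 : ℝ) • ![-a 1, a 0, a 3, -a 2]) ((12 : ℝ) • u₃) (fun i => by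
    fin_cases i <;> apply Complex.ext <;>
      simp [hu₂, hu₃, planeSection, baseFrame₄, lin, Fin.sum_univ_four] <;> ring) (h 2)
  obtain ⟨e7, e8⟩ := quad_add_I_mul hS
    ((18 : ℝ) • u₁ + (30 : ℝ) • u₂ + (18 : ℝ) • ![-a 1, a 0, a 3, -a 2]) ((30 : ℝ) • u₃)
    (fun i => by
    fin_cases i <;> apply Complex.ext <;>
      simp [hu₁, hu₂, hu₃, planeSection, baseFrame₄, lin, Fin.sum_univ_four] <;> ring) (h 3)
  have c1 := dotProduct_mulVec_comm hS u₂ u₁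
  have c2 := dotProduct_mulVec_comm hS u₃ u₁
  have c3 := dotProduct_mulVec_comm hS u₃ u₂
  rw [hF] at e5 e6 e7 e8
  simp only [Matrix.mulVec_add, Matrix.mulVec_smul, dotProduct_add, add_dotProduct,
    smul_dotProduct, dotProduct_smul, smul_eq_mul, c1, c2, c3, e2, e4, ← e3, ← e1]
    at e5 e6 e7 e8
  -- By the first two points, the form is `l (x₁² + x₂² + x₃²) + 2 m x₁ x₃` in the basis `u`.
  set l := u₁ ⬝ᵥ (S *ᵥ u₁)
  set m := u₁ ⬝ᵥ (S *ᵥ u₃)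
  -- The imaginary parts of the conditions at the last two lines differ by a multiple of `m`.
  have hm : m = 0 := by linarith
  rw [hm] at e5 e6 e7
  have hl : l = 0 := by
    have f1 : l * r₃ = 0 := by linarith
    have f2 : l * (3 + 5 * r₂) = 0 := by
      linear_combination e5 / 54 - (3 / 2) * l * hr
    have f3 : l * r₁ = 0 := by
      linear_combination e7 / 648 - f2 / 3 - (1 / 2) * l * hr
    by_contra hne
    have g1 : r₃ = 0 := (mul_eq_zero.1 f1).resolve_left hne
    have g2 : 3 + 5 * r₂ = 0 := (mul_eq_zero.1 f2).resolve_left hne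
    have g3 : r₁ = 0 := (mul_eq_zero.1 f3).resolve_left hne
    rw [g1, g3] at hr
    nlinarith
  intro x hx
  have hx' : a 0 * x 0 + a 1 * x 1 + a 2 * x 2 + a 3 * x 3 = 0 := by
    simpa [dotProduct, Fin.sum_univ_four] using hx
  refine quadratic_eq_zero_of_span hS (u₁ := u₁) (u₂ := u₂) (u₃ := u₃)
    (c₁ := -a 1 * x 0 + a 0 * x 1 - a 3 * x 2 + a 2 * x 3)
    (c₂ := -a 2 * x 0 + a 3 * x 1 + a 0 * x 2 - a 1 * x 3)
    (c₃ := -a 3 * x 0 - a 2 * x 1 + a 1 * x 2 + a 0 * x 3) ?_ hl ?_ ?_ e2 hm e4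
  · ext i
    fin_cases i <;> simp [hu₁, hu₂, hu₃]
    · linear_combination -x 0 * hN + a 0 * hx'
    · linear_combination -x 1 * hN + a 1 * hx'
    · linear_combination -x 2 * hN + a 2 * hx'
    · linear_combination -x 3 * hN + a 3 * hx'
  · linarith
  · linarith

/-! ### Openness -/

/-- The quotient map from frames to lines is open: the saturation of an open set is the union of
its translates under change of frame. -/
theorem isOpenMap_ofFrame : IsOpenMap Line.ofFrame := by
  intro W hW
  change IsOpen (Line.ofFrame ⁻¹' (Line.ofFrame '' W))
  obtain ⟨W', hW', rfl⟩ := isOpen_induced_iff.1 hW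
  rw [isOpen_iff_mem_nhds]
  rintro f ⟨g, hg, hgf⟩
  have hspan : Submodule.span ℂ (Set.range g.1) = Submodule.span ℂ (Set.range f.1) :=
    congrArg Subtype.val hgf
  have hgm (i : Fin 2) : ∃ c : Fin 2 → ℂ, ∑ j, c j • f.1 j = g.1 i :=
    (Submodule.mem_span_range_iff_exists_fun ℂ).1
      (hspan ▸ Submodule.subset_span (Set.mem_range_self i))
  have hfm (i : Fin 2) : ∃ c : Fin 2 → ℂ, ∑ j, c j • g.1 j = f.1 i :=
    (Submodule.mem_span_range_iff_exists_fun ℂ).1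
      (hspan ▸ Submodule.subset_span (Set.mem_range_self i))
  choose M hM using hgm
  choose N hN using hfm
  let φ : (Fin 2 → V) → (Fin 2 → V) := fun f' i => ∑ j, M i j • f' j
  have hφ : Continuous φ := by fun_prop
  -- `N` inverts `M`, because both express the same frames in terms of each other.
  have hNM (i k : Fin 2) : ∑ j, N i j * M j k = if k = i then 1 else 0 := by
    have h : ∑ k, (∑ j, N i j * M j k) • f.1 k = ∑ k, (if k = i then (1 : ℂ) else 0) • f.1 k := by
      simp only [ite_smul, one_smul, zero_smul, Finset.sum_ite_eq', Finset.mem_univ, if_true]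
      rw [← hN i]
      simp only [← hM, Finset.smul_sum, Finset.sum_smul, smul_smul]
      exact Finset.sum_comm
    have := Fintype.linearIndependent_iff.1 f.2
      (fun k => ∑ j, N i j * M j k - if k = i then (1 : ℂ) else 0)
      (by simp only [sub_smul, Finset.sum_sub_distrib, h, sub_self]) k
    exact sub_eq_zero.1 this
  have hspanφ (f' : Fin 2 → V) :
      Submodule.span ℂ (Set.range (φ f')) = Submodule.span ℂ (Set.range f') := by
    apply le_antisymm <;> rw [Submodule.span_le] <;> rintro _ ⟨i, rfl⟩
    · exact Submodule.sum_mem _ fun j _ =>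
        Submodule.smul_mem _ _ (Submodule.subset_span (Set.mem_range_self j))
    · have : f' i = ∑ j, N i j • φ f' j := by
        simp only [φ, Finset.smul_sum, smul_smul]
        rw [Finset.sum_comm]
        simp only [← Finset.sum_smul, hNM, ite_smul, one_smul, zero_smul, Finset.sum_ite_eq',
          Finset.mem_univ, if_true]
      rw [SetLike.mem_coe, this]
      exact Submodule.sum_mem _ fun j _ =>
        Submodule.smul_mem _ _ (Submodule.subset_span (Set.mem_range_self j))
  have hmem : {f' : {f : Fin 2 → V // LinearIndependent ℂ f} | φ f'.1 ∈ W'} ∈ nhds f := by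
    refine (hW'.preimage (hφ.comp continuous_subtype_val)).mem_nhds ?_
    have : φ f.1 = g.1 := funext hM
    change φ f.1 ∈ W'
    rw [this]
    exact hg
  filter_upwards [hmem] with f' hf'
  refine ⟨⟨φ f'.1, ?_⟩, hf', Subtype.ext (hspanφ f'.1)⟩
  rw [linearIndependent_iff_card_eq_finrank_span, Set.finrank, hspanφ f'.1,
    finrank_span_eq_card f'.2]

/-- The quotient map from nonzero vectors to points is open. -/
theorem isOpenMap_mk :
    IsOpenMap (fun v : {v : V // v ≠ 0} => Projectivization.mk ℂ v.1 v.2) := by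
  intro W hW
  change IsOpen ((fun v : {v : V // v ≠ 0} => Projectivization.mk ℂ v.1 v.2) ⁻¹'
    ((fun v : {v : V // v ≠ 0} => Projectivization.mk ℂ v.1 v.2) '' W))
  obtain ⟨W', hW', rfl⟩ := isOpen_induced_iff.1 hW
  rw [isOpen_iff_mem_nhds]
  rintro v ⟨w, hw, hwv⟩
  obtain ⟨c, hc⟩ := (Projectivization.mk_eq_mk_iff ℂ _ _ w.2 v.2).1 hwv
  have hmem : {v' : {v : V // v ≠ 0} | (c : ℂ) • v'.1 ∈ W'} ∈ nhds v := by
    refine (hW'.preimage (continuous_subtype_val.const_smul (c : ℂ))).mem_nhds ?_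
    change (c : ℂ) • v.1 ∈ W'
    rw [show (c : ℂ) • v.1 = w.1 from hc]
    exact hw
  filter_upwards [hmem] with v' hv'
  exact ⟨⟨(c : ℂ) • v'.1, smul_ne_zero c.ne_zero v'.2⟩, hv',
    (Projectivization.mk_eq_mk_iff ℂ _ _ _ _).2 ⟨c, rfl⟩⟩

/-- Since the space of normalized conics is compact, a closed condition that no normalized conic
satisfies at `x₀` is not satisfied by any normalized conic at the points of a neighbourhood. -/
theorem exists_isOpen_forall_normalizedConics {X : Type*} [TopologicalSpace X] {x₀ : X}
    {P : X → (Fin 4 → ℝ) × Matrix (Fin 4) (Fin 4) ℝ → Prop}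
    (hP : IsClosed {y : X × ((Fin 4 → ℝ) × Matrix (Fin 4) (Fin 4) ℝ) | P y.1 y.2})
    (h : ∀ k ∈ normalizedConics, ¬ P x₀ k) :
    ∃ W : Set X, IsOpen W ∧ x₀ ∈ W ∧ ∀ x ∈ W, ∀ k ∈ normalizedConics, ¬ P x k := by
  have := isCompact_normalizedConics.eventually_forall_of_forall_eventually (x₀ := x₀)
    (P := fun x k => ¬ P x k) fun k hk => hP.isOpen_compl.mem_nhds (h k hk)
  obtain ⟨W, hW, hWo, hx⟩ := mem_nhds_iff.1 this
  exact ⟨W, hWo, hx, hW⟩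

@[fun_prop]
theorem continuous_lin {X : Type*} [TopologicalSpace X] {a : X → Fin 4 → ℝ} {v : X → V}
    (ha : Continuous a) (hv : Continuous v) : Continuous fun x => lin (a x) (v x) := by
  unfold lin
  fun_prop

@[fun_prop]
theorem continuous_quad {X : Type*} [TopologicalSpace X] {S : X → Matrix (Fin 4) (Fin 4) ℝ}
    {v : X → V} (hS : Continuous S) (hv : Continuous v) :
    Continuous fun x => quad (S x) (v x) := by
  unfold quad
  fun_prop

@[fun_prop]
theorem continuous_planeSection {X : Type*} [TopologicalSpace X] {a : X → Fin 4 → ℝ}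
    {f : X → Fin 2 → V} (ha : Continuous a) (hf : Continuous f) :
    Continuous fun x => planeSection (a x) (f x) := by
  unfold planeSection
  fun_prop

/-- Bases of 2-dimensional subspaces of `ℂ⁴`. -/
abbrev Frame : Type := {f : Fin 2 → V // LinearIndependent ℂ f}

theorem exists_isOpen_point_two_lines : ∃ U : Set (P3 × Line × Line), IsOpen U ∧ U.Nonempty ∧
    ∀ (p : P3) (L₁ L₂ : Line), (p, L₁, L₂) ∈ U →
      ¬ ∃ C : RealConic, C.PassesThrough p ∧ C.Meets L₁ ∧ C.Meets L₂ := by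
  let x₀ : {v : V // v ≠ 0} × Frame × Frame :=
    (⟨basePoint, basePoint_ne_zero⟩, ⟨baseFrame₂ 0, linearIndependent_baseFrame₂ 0⟩,
      ⟨baseFrame₂ 1, linearIndependent_baseFrame₂ 1⟩)
  let P (x : {v : V // v ≠ 0} × Frame × Frame) (k : (Fin 4 → ℝ) × Matrix (Fin 4) (Fin 4) ℝ) :
      Prop := (lin k.1 x.1.1 = 0 ∧ quad k.2 x.1.1 = 0) ∧
    quad k.2 (planeSection k.1 x.2.1.1) = 0 ∧ quad k.2 (planeSection k.1 x.2.2.1) = 0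
  have hP : IsClosed {y : ({v : V // v ≠ 0} × Frame × Frame) × _ | P y.1 y.2} :=
    ((isClosed_eq (by fun_prop) continuous_const).inter
      (isClosed_eq (by fun_prop) continuous_const)).inter
    ((isClosed_eq (by fun_prop) continuous_const).inter
      (isClosed_eq (by fun_prop) continuous_const))
  obtain ⟨W, hWo, hW, h⟩ := exists_isOpen_forall_normalizedConics (x₀ := x₀) hP
    fun k hk hx => basePoint_baseFrame₂_not_mem hx.1.1 hx.1.2 (Fin.forall_fin_two.2 hx.2) hk
  refine ⟨_, (isOpenMap_mk.prodMap (isOpenMap_ofFrame.prodMap isOpenMap_ofFrame)) W hWo,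
    ⟨_, x₀, hW, rfl⟩, ?_⟩
  rintro _ _ _ ⟨⟨v, f, g⟩, hx, ⟨⟩⟩ ⟨C, hp, hf, hg⟩
  obtain ⟨k, hk, hCk⟩ := C.exists_normalized
  obtain ⟨hl, hq⟩ := RealConic.eq_zero_of_passesThrough_mk v.2 hp
  obtain ⟨s, t, hst, hl₁, hq₁⟩ := RealConic.exists_of_meets_ofFrame hf
  obtain ⟨s', t', hst', hl₂, hq₂⟩ := RealConic.exists_of_meets_ofFrame hg
  exact h _ hx k hk ⟨hCk _ hl hq,
    quad_planeSection_eq_zero hst (hCk _ hl₁ hq₁).1 (hCk _ hl₁ hq₁).2,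
    quad_planeSection_eq_zero hst' (hCk _ hl₂ hq₂).1 (hCk _ hl₂ hq₂).2⟩

theorem exists_isOpen_four_lines : ∃ U : Set (Fin 4 → Line), IsOpen U ∧ U.Nonempty ∧
    ∀ L : Fin 4 → Line, L ∈ U → ¬ ∃ C : RealConic, ∀ i : Fin 4, C.Meets (L i) := by
  let x₀ : Fin 4 → Frame := fun i => ⟨baseFrame₄ i, linearIndependent_baseFrame₄ i⟩
  let P (x : Fin 4 → Frame) (k : (Fin 4 → ℝ) × Matrix (Fin 4) (Fin 4) ℝ) : Prop :=
    ∀ i, quad k.2 (planeSection k.1 (x i).1) = 0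
  have hP : IsClosed {y : (Fin 4 → Frame) × _ | P y.1 y.2} := by
    simp only [P, Set.ofPred_forall]
    exact isClosed_iInter fun i => isClosed_eq (by fun_prop) continuous_const
  obtain ⟨W, hWo, hW, h⟩ := exists_isOpen_forall_normalizedConics (x₀ := x₀) hP
    fun k hk hx => baseFrame₄_not_mem hx hk
  refine ⟨_, (IsOpenMap.piMap (fun _ => isOpenMap_ofFrame)
    (Filter.eventually_cofinite.2 (Set.toFinite _))) W hWo, ⟨_, x₀, hW, rfl⟩, ?_⟩
  rintro _ ⟨f, hf, rfl⟩ ⟨C, hC⟩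
  obtain ⟨k, hk, hCk⟩ := C.exists_normalized
  refine h f hf k hk fun i => ?_
  obtain ⟨s, t, hst, hl, hq⟩ := RealConic.exists_of_meets_ofFrame (hC i)
  exact quad_planeSection_eq_zero hst (hCk _ hl hq).1 (hCk _ hl hq).2

end RealConics

theorem mainTheorem7 :
    (∃ U : Set (RealConics.P3 × RealConics.Line × RealConics.Line),
      IsOpen U ∧ U.Nonempty ∧
      ∀ (p : RealConics.P3) (L₁ L₂ : RealConics.Line), (p, L₁, L₂) ∈ U →
        ¬ ∃ C : RealConics.RealConic,
          C.PassesThrough p ∧ C.PassesThrough (RealConics.conjPoint p) ∧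
          C.Meets L₁ ∧ C.Meets (RealConics.conjLine L₁) ∧
          C.Meets L₂ ∧ C.Meets (RealConics.conjLine L₂)) ∧
    (∃ U : Set (Fin 4 → RealConics.Line),
      IsOpen U ∧ U.Nonempty ∧
      ∀ L : Fin 4 → RealConics.Line, L ∈ U →
        ¬ ∃ C : RealConics.RealConic,
          ∀ i : Fin 4, C.Meets (L i) ∧ C.Meets (RealConics.conjLine (L i))) := by
  -- A real conic that contains a point also contains the conjugate point, so that the conditions on
  -- the conjugates are redundant.
  obtain ⟨U, hU, hne, h⟩ := RealConics.exists_isOpen_point_two_lines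
  obtain ⟨U', hU', hne', h'⟩ := RealConics.exists_isOpen_four_lines
  exact ⟨⟨U, hU, hne, fun p L₁ L₂ hL ⟨C, hp, _, h₁, _, h₂, _⟩ => h p L₁ L₂ hL ⟨C, hp, h₁, h₂⟩⟩,
    U', hU', hne', fun L hL ⟨C, hC⟩ => h' L hL ⟨C, fun i => (hC i).1⟩⟩
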